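/- **Theorem.** Let $(W,S)$ be a Coxeter system with $W$ finite and simply laced (i.e. $m(s,t)\in\{2,3\}$ for all distinct $s,t\in S$), let $V$ be its (real) root space, with basis the simple roots $\alpha_s$ $(s\in S)$ and the geometric action of $W$, let $T=\{wsw^{-1}: w\in W, s\in S\}$ be the set of reflections, and for $t\in T$ let $\alpha_t$ be the positive root corresponding to $t$. Let $f\in V^*$ be $W$-generic, i.e. $\langle f,\alpha_t\rangle\notin\{0,1,-1\}$ for all $t\in T$. For $v\in W$ put $A_f=\{t\in T:\langle f,\alpha_t\rangle=\pm1\}$, $\mathrm{Des}_{A_f}(v)=\{t\in A_f:\ell(tv)<\ell(v)\}$ and $\mathcal K^f_v=\{u\in W: \mathrm{Des}_{A_f}(u)=\mathrm{Des}_{A_f}(v)\}$. A functional $f$ is called $\mathcal K$-generic, for a subset $\mathcal K\ni \mathrm{id}$ of $W$ that is convex in the Hasse diagram of the right weak order, if (i) $\langle f,\alpha_{wsw^{-1}}\rangle\notin\{0,\pm1\}$ whenever $s\in S$ and $w,ws\in\mathcal K$; (ii) $\langle f,\alpha_{wsw^{-1}}\rangle=\pm1$ whenever $s\in S$, $w\in\mathcal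 K$, $ws\notin\mathcal K$; (iii) $\langle f,\alpha_{wsw^{-1}}\rangle=\langle f,\alpha_{wtw^{-1}}\rangle$ whenever $w\in\mathcal K$, $s,t\in S$, $m(s,t)=3$ and $ws,wt\notin\mathcal K$. Then for every $v\in W$ we have $\mathcal K^f_v=W$, and $f$ is $\mathcal K^f_v$-generic. Moreover, let $\mathbb F$ be any field containing $\mathbb R$, put $\dot a_t=1/\langle f,\alpha_t\rangle$ and $\ddot a_t=-\dot a_t$, and let $\dot b_t,\ddot b_t\in\mathbb F$ $(t\in T)$ be any scalars with $\dot b_t\ddot b_t=(1-\dot a_t)(1-\ddot a_t)$ (for example the symmetric normalization $\dot b_t=\ddot b_t$, when such scalars exist in $\mathbb F$, as they do for $\mathbb F=\mathbb C$). Then there is exactly one representation $\rho=\rho^f_v$ of $W$ on $V_W=\mathrm{span}_{\mathbb F}\{C_w: w\in W\}$ (the $C_w$ being a basis) such that for all $s\in S$ and $w\in W$, with $t=wsw^{-1}$, $$\rho_s(C_w)=\begin{cases}\dot a_tC_w+\dot b_tC_{ws},&\ell(w)<\ell(ws),\\ \ddot a_tC_w+\ddot b_tC_{ws},&\ell(w)>\ell(ws),\end{cases}$$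 and $\rho^f_v$ is isomorphic to the regular representation of $W$ over $\mathbb F$. -/

import Mathlib

noncomputable section

namespace CoxeterMatrix

variable {B : Type*} (M : CoxeterMatrix B)

/-- A Coxeter matrix is simply laced if `m(s,t) ∈ {2, 3}` for all distinct generators `s, t`. -/
def IsSimplyLaced : Prop := ∀ i j : B, i ≠ j → M i j = 2 ∨ M i j = 3

/-- The linear functional `v ↦ B(α_i, v)` on the root space `V`, the real vector space with
basis the simple roots `α_i` (`Finsupp.single i 1`). It is determined by
`B(α_i, α_j) = - cos (π / m(i,j))`. The value `0` encodes `m = ∞` in Mathlib; then `π / 0 = 0`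
and the formula gives `B(α_i, α_j) = -1`, which is the usual convention. -/
def rootPairing (i : B) : Module.Dual ℝ (B →₀ ℝ) :=
  Finsupp.linearCombination ℝ fun j => - Real.cos (Real.pi / (M i j : ℝ))

/-- The canonical symmetric bilinear form on the root space. -/
def rootForm : (B →₀ ℝ) →ₗ[ℝ] Module.Dual ℝ (B →₀ ℝ) :=
  Finsupp.linearCombination ℝ M.rootPairing

/-- The reflection `v ↦ v - 2 B(β, v) β` of the root space. -/
def rootReflection (β : B →₀ ℝ) : Module.End ℝ (B →₀ ℝ) :=
  Module.preReflection β ((2 : ℝ) • M.rootForm β)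

theorem rootForm_single_single (i j : B) :
    M.rootForm (Finsupp.single i 1) (Finsupp.single j 1) = - Real.cos (Real.pi / (M i j : ℝ)) := by
  simp [rootForm, rootPairing]

theorem rootReflection_apply (β v : B →₀ ℝ) :
    M.rootReflection β v = v - (2 * M.rootForm β v) • β := by
  simp [rootReflection, Module.preReflection_apply]

/-- The reflections in the simple roots satisfy the Coxeter relations. -/
theorem rootReflection_isLiftable :
    M.IsLiftable (fun i => M.rootReflection (Finsupp.single i 1)) := by
  have h2 : ∀ i, ((2 : ℝ) • M.rootForm (Finsupp.single i 1)) (Finsupp.single i 1) = 2 := by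
    intro i; simp [rootForm_single_single]
  intro i j
  have key : ∀ m : ℕ,
      (Module.reflection (h2 i) * Module.reflection (h2 j)) ^ m = 1 →
      (M.rootReflection (Finsupp.single i 1) * M.rootReflection (Finsupp.single j 1)) ^ m = 1 := by
    intro m hm
    have h := congrArg (fun e : (B →₀ ℝ) ≃ₗ[ℝ] (B →₀ ℝ) =>
      (LinearEquiv.automorphismGroup.toLinearMapMonoidHom (R := ℝ) (M := B →₀ ℝ)) e) hm
    simp only [map_pow, map_mul, map_one] at h
    exact h
  apply key
  by_cases hij : i = j
  · subst hij
    rw [M.diagonal, pow_one]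
    ext1 v
    exact Module.involutive_reflection (h2 i) v
  by_cases h0 : M i j = 0
  · rw [h0, pow_zero]
  have h1 := M.off_diagonal i j hij
  set c := Real.cos (Real.pi / (M i j : ℝ)) with hc
  have hxy : ((2 : ℝ) • M.rootForm (Finsupp.single i 1)) (Finsupp.single j 1) = -(2 * c) := by
    simp [rootForm_single_single, hc]
  have hyx : ((2 : ℝ) • M.rootForm (Finsupp.single j 1)) (Finsupp.single i 1) = -(2 * c) := by
    simp [rootForm_single_single, hc, M.symmetric j i]
  by_cases hm2 : M i j = 2
  · have hc0 : c = 0 := by simp [hc, hm2]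
    rw [hc0] at hxy hyx
    ext1 v
    rw [hm2, pow_two]
    simp only [LinearEquiv.mul_apply, Module.reflection_apply, map_sub, map_smul, hxy, hyx, h2,
      LinearEquiv.coe_one, id]
    module
  have hm3 : 3 ≤ M i j := by omega
  set θ : ℝ := 2 * (Real.pi / (M i j : ℝ)) with hθ
  have hmpos : (0 : ℝ) < (M i j : ℝ) := by positivity
  have hmθ : (M i j : ℝ) * θ = 2 * Real.pi := by rw [hθ]; field_simp
  have hsin : Real.sin θ ≠ 0 := by
    have hm3' : (3 : ℝ) ≤ (M i j : ℝ) := by exact_mod_cast hm3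
    apply ne_of_gt
    have := Real.pi_pos
    apply Real.sin_pos_of_pos_of_lt_pi
    · positivity
    · nlinarith
  have ht : 2 * Real.cos θ =
      ((2 : ℝ) • M.rootForm (Finsupp.single i 1)) (Finsupp.single j 1) *
      ((2 : ℝ) • M.rootForm (Finsupp.single j 1)) (Finsupp.single i 1) - 2 := by
    rw [hxy, hyx, hθ, Real.cos_two_mul, ← hc]; ring
  have hS := fun n : ℤ => Polynomial.Chebyshev.S_two_mul_real_cos (θ := θ) n
  ext1 v
  rw [Module.reflection_mul_reflection_pow_apply (h2 i) (h2 j) (M i j) v _ ht]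
  set S := fun n : ℤ => (Polynomial.Chebyshev.S ℝ n).eval (2 * Real.cos θ) with hSdef
  have hA : S (((M i j : ℤ) - 2) / 2) *
      (S (((M i j : ℤ) - 1) / 2) + S (((M i j : ℤ) - 3) / 2)) = 0 ∧
      S (((M i j : ℤ) - 1) / 2) * (S ((M i j : ℤ) / 2) + S (((M i j : ℤ) - 2) / 2)) = 0 := by
    rcases Nat.even_or_odd' (M i j) with ⟨k, hk | hk⟩
    · have hkθ : (k : ℝ) * θ = Real.pi := by
        rw [hk] at hmθ; push_cast at hmθ; linarith
      have e1 : ((M i j : ℤ) - 2) / 2 = k - 1 := by omega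
      have e2 : ((M i j : ℤ) - 1) / 2 = k - 1 := by omega
      have z : S ((k : ℤ) - 1) = 0 := by
        have := hS ((k : ℤ) - 1)
        push_cast at this
        rw [sub_add_cancel, hkθ, Real.sin_pi] at this
        exact (mul_eq_zero.mp this).resolve_right hsin
      rw [e1, e2, z]; simp
    · have hkθ : (k : ℝ) * θ = Real.pi - θ / 2 := by
        rw [hk] at hmθ; push_cast at hmθ; linarith
      have e1 : ((M i j : ℤ) - 2) / 2 = k - 1 := by omega
      have e2 : ((M i j : ℤ) - 1) / 2 = k := by omega
      have e3 : ((M i j : ℤ) - 3) / 2 = k - 1 := by omega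
      have e4 : (M i j : ℤ) / 2 = k := by omega
      have z : S (k : ℤ) + S ((k : ℤ) - 1) = 0 := by
        have a := hS (k : ℤ)
        have b := hS ((k : ℤ) - 1)
        push_cast at a b
        rw [sub_add_cancel, hkθ, Real.sin_pi_sub] at b
        rw [add_mul, one_mul, hkθ, show Real.pi - θ / 2 + θ = θ / 2 + Real.pi by ring,
          Real.sin_add_pi] at a
        have : (S (k : ℤ) + S ((k : ℤ) - 1)) * Real.sin θ = 0 := by
          rw [add_mul]; simp only [hSdef]; rw [a, b]; ring
        exact (mul_eq_zero.mp this).resolve_right hsin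
      rw [e1, e2, e3, e4, z]; simp
  simp only [hSdef] at hA
  rw [hA.1, hA.2]
  simp

end CoxeterMatrix

namespace CoxeterSystem

variable {B : Type*} {M : CoxeterMatrix B} {W : Type*} [Group W] (cs : CoxeterSystem M W)

/-- The geometric representation of `W` on its root space: the simple reflection `s_i` acts by
`v ↦ v - 2 B(α_i, v) α_i`. -/
def geomRep : W →* Module.End ℝ (B →₀ ℝ) :=
  cs.lift ⟨fun i => M.rootReflection (Finsupp.single i 1), M.rootReflection_isLiftable⟩

/-- `β` is the positive root corresponding to `t`: it is a root (in the `W`-orbit of a simple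
root), its coordinates in the basis of simple roots are nonnegative, and `t` acts on the root
space as the reflection in `β`. -/
def IsPosRootOf (t : W) (β : B →₀ ℝ) : Prop :=
  (∃ (w : W) (i : B), β = cs.geomRep w (Finsupp.single i 1)) ∧ (∀ i, 0 ≤ β i) ∧
    cs.geomRep t = M.rootReflection β

/-- The positive root `α_t` of a reflection `t`. (Every reflection has exactly one positive
root; only the values at reflections are used.) -/
def posRoot (t : W) : B →₀ ℝ := Classical.epsilon (cs.IsPosRootOf t)

/-- `T_K = {w s w⁻¹ | s ∈ S, w ∈ K, w s ∈ K}`. -/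
def innerReflections (K : Set W) : Set W :=
  {t | ∃ (i : B) (w : W), w ∈ K ∧ w * cs.simple i ∈ K ∧ t = w * cs.simple i * w⁻¹}

/-- `T_∂K = {w s w⁻¹ | s ∈ S, w ∈ K, w s ∉ K}`. -/
def boundaryReflections (K : Set W) : Set W :=
  {t | ∃ (i : B) (w : W), w ∈ K ∧ w * cs.simple i ∉ K ∧ t = w * cs.simple i * w⁻¹}

/-- `K` is convex in the Hasse diagram of the right weak order (the graph with edges
`{w, w s}`, `s ∈ S`): every vertex on a shortest path between two elements of `K` is in `K`. -/
def IsWeakConvex (K : Set W) : Prop :=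
  ∀ u ∈ K, ∀ v ∈ K, ∀ w : W,
    cs.length (u⁻¹ * w) + cs.length (w⁻¹ * v) = cs.length (u⁻¹ * v) → w ∈ K

/-- `K`-genericity of a linear functional `f` on the root space, for a convex subset `K` of `W`
containing the identity. -/
structure IsGeneric (K : Set W) (f : Module.Dual ℝ (B →₀ ℝ)) : Prop where
  convex : cs.IsWeakConvex K
  one_mem : (1 : W) ∈ K
  inner : ∀ t ∈ cs.innerReflections K, f (cs.posRoot t) ∉ ({0, 1, -1} : Set ℝ)
  boundary : ∀ t ∈ cs.boundaryReflections K, f (cs.posRoot t) ∈ ({1, -1} : Set ℝ)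
  corner : ∀ w ∈ K, ∀ i j : B, M i j = 3 → w * cs.simple i ∉ K → w * cs.simple j ∉ K →
    f (cs.posRoot (w * cs.simple i * w⁻¹)) = f (cs.posRoot (w * cs.simple j * w⁻¹))

/-- The left `A`-descent set `Des_A(w) = {t ∈ A | ℓ(t w) < ℓ(w)}` for a set `A` of reflections. -/
def descentSet (A : Set W) (w : W) : Set W := {t ∈ A | cs.length (t * w) < cs.length w}

/-- `A_f = {t ∈ T | ⟨f, α_t⟩ ∈ {1, -1}}`. -/
def unitReflections (f : Module.Dual ℝ (B →₀ ℝ)) : Set W :=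
  {t | cs.IsReflection t ∧ f (cs.posRoot t) ∈ ({1, -1} : Set ℝ)}

/-- The cell `K^f_v`, the set of all `u` having the same `A_f`-descent set as `v`. -/
def cell (f : Module.Dual ℝ (B →₀ ℝ)) (v : W) : Set W :=
  {u | cs.descentSet (cs.unitReflections f) u = cs.descentSet (cs.unitReflections f) v}

variable (F : Type*) [Field F] [Algebra ℝ F]

/-- The scalar `ȧ_t = 1 / ⟨f, α_t⟩`; its partner is `ä_t = - ȧ_t`. -/
def aDot (f : Module.Dual ℝ (B →₀ ℝ)) (t : W) : F := algebraMap ℝ F (1 / f (cs.posRoot t))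

/-- A choice of the scalars `ḃ_t` and `b̈_t`, subject to `ḃ_t b̈_t = (1 - ȧ_t)(1 - ä_t)`.
The symmetric normalization is the case `ḃ = b̈`; the row stochastic one is
`ȧ + ḃ = ä + b̈ = 1`. -/
structure Normalization (K : Set W) (f : Module.Dual ℝ (B →₀ ℝ)) where
  bDot : W → F
  bDDot : W → F
  mul_eq : ∀ t ∈ cs.innerReflections K ∪ cs.boundaryReflections K,
    bDot t * bDDot t = (1 - cs.aDot F f t) * (1 - (- cs.aDot F f t))

variable {F}

open Classical in
/-- The vector `c • C_u` of `V_K = span {C_w | w ∈ K}`, understood as `0` if `u ∉ K`. -/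
def cellVector (K : Set W) (u : W) (c : F) : K →₀ F :=
  if h : u ∈ K then Finsupp.single ⟨u, h⟩ c else 0

/-- `ρ` is the abstract Young representation on `V_K` attached to `f` and the normalization `N`:
with `t = w s w⁻¹`,
`ρ_s(C_w) = ȧ_t C_w + ḃ_t C_{ws}` if `ℓ(w) < ℓ(ws)`, and
`ρ_s(C_w) = ä_t C_w + b̈_t C_{ws}` if `ℓ(w) > ℓ(ws)`, the second term being absent if `ws ∉ K`. -/
def IsYoungRep (K : Set W) (f : Module.Dual ℝ (B →₀ ℝ)) (N : cs.Normalization F K f)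
    (ρ : Representation F W (K →₀ F)) : Prop :=
  ∀ (i : B) (w : K),
    (cs.length (w : W) < cs.length ((w : W) * cs.simple i) →
      ρ (cs.simple i) (Finsupp.single w 1) =
        Finsupp.single w (cs.aDot F f (w * cs.simple i * (w : W)⁻¹)) +
        cellVector K (w * cs.simple i) (N.bDot (w * cs.simple i * (w : W)⁻¹))) ∧
    (cs.length ((w : W) * cs.simple i) < cs.length (w : W) →
      ρ (cs.simple i) (Finsupp.single w 1) =
        Finsupp.single w (- cs.aDot F f (w * cs.simple i * (w : W)⁻¹)) +
        cellVector K (w * cs.simple i) (N.bDDot (w * cs.simple i * (w : W)⁻¹)))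

end CoxeterSystem

end

/-! ### The invariant form and unit vectors. -/

noncomputable section

namespace CoxeterMatrix

variable {B : Type*} (M : CoxeterMatrix B)

/-! Genericity leaves no reflection with value ±1, so all descent sets over the empty set agree: the
cell is `W`, and the boundary and corner conditions are vacuous.

For the representation, the case split on length disappears if each pair (w, i) carries the signed
root `w α_i` instead of the positive root of `w s_i w⁻¹`. These agree up to a sign, positive exactly
when `ℓ(w) < ℓ(w s_i)` (`rootAt_nonneg`, `posRoot_eq_rootAt`), so in both cases the diagonal
coefficient is `1 / f(w α_i)`. The Coxeter relations for the operators then follow from how roots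
move in rank two. The only analytic input is `1/(xy) = (1/(x+y)) (1/x + 1/y)` for the braid
relation, where `x + y` is the value of `f` at a third root (`op_braid`, `youngData`).

Uniqueness holds because the simple reflections generate `W`. Since `f` avoids ±1, every
off-diagonal coefficient is nonzero, so `C_1` is a cyclic vector. The resulting surjection from the
regular representation is bijective by dimension. -/

theorem rootForm_comm (v w : B →₀ ℝ) : M.rootForm v w = M.rootForm w v := by
  have h : M.rootForm = M.rootForm.flip := by
    ext i j
    simp [rootForm_single_single, M.symmetric i j]
  exact LinearMap.congr_fun₂ h v w

theorem rootForm_single_self (i : B) :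
    M.rootForm (Finsupp.single i 1) (Finsupp.single i 1) = 1 := by
  simp [rootForm_single_single]

theorem rootForm_rootReflection {β : B →₀ ℝ} (hβ : M.rootForm β β = 1) (v w : B →₀ ℝ) :
    M.rootForm (M.rootReflection β v) (M.rootReflection β w) = M.rootForm v w := by
  simp only [rootReflection_apply, map_sub, map_smul, LinearMap.sub_apply, LinearMap.smul_apply,
    smul_eq_mul, hβ, M.rootForm_comm v β]
  ring

theorem rootReflection_self {β : B →₀ ℝ} (hβ : M.rootForm β β = 1) :
    M.rootReflection β β = -β := by
  rw [rootReflection_apply, hβ]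
  module

/-- A unit vector with nonnegative coordinates is determined by its reflection. -/
theorem eq_of_rootReflection_eq {β γ : B →₀ ℝ} (hβ : M.rootForm β β = 1)
    (hγ : M.rootForm γ γ = 1) (hβ0 : 0 ≤ β) (hγ0 : 0 ≤ γ)
    (h : M.rootReflection β = M.rootReflection γ) : β = γ := by
  have h1 : β = M.rootForm γ β • γ := by
    -- Evaluating both reflections at `β` gives `-β = β - 2 B(γ, β) γ`, so `β` is a multiple of `γ`.
    have h2 := LinearMap.congr_fun h β
    rw [M.rootReflection_self hβ, rootReflection_apply] at h2
    have h3 : (2 : ℝ) • β = (2 : ℝ) • (M.rootForm γ β • γ) := by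
      rw [smul_smul, ← sub_eq_iff_eq_add'.mpr (sub_eq_iff_eq_add.mp h2.symm)]
      module
    exact smul_right_injective _ (two_ne_zero' ℝ) h3
  set c := M.rootForm γ β
  have hc : c * c = 1 := by
    rw [h1] at hβ
    simpa [hγ] using hβ
  rcases mul_self_eq_one_iff.mp hc with hc | hc
  · rw [h1, hc, one_smul]
  · have : β = -γ := by rw [h1, hc, neg_one_smul]
    have hγ' : γ = 0 := le_antisymm (by rw [this] at hβ0; simpa using hβ0) hγ0
    simp [hγ'] at hγ

end CoxeterMatrix

/-! ### Roots `w α_i` and their signs. -/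

namespace CoxeterSystem

variable {B : Type*} {M : CoxeterMatrix B} {W : Type*} [Group W] (cs : CoxeterSystem M W)

/-- The image `w α_i` of a simple root. -/
def rootAt (w : W) (i : B) : B →₀ ℝ := cs.geomRep w (Finsupp.single i 1)

theorem geomRep_simple (i : B) :
    cs.geomRep (cs.simple i) = M.rootReflection (Finsupp.single i 1) :=
  cs.lift_apply_simple M.rootReflection_isLiftable i

theorem rootForm_geomRep (w : W) (x y : B →₀ ℝ) :
    M.rootForm (cs.geomRep w x) (cs.geomRep w y) = M.rootForm x y := by
  induction w using cs.simple_induction_left with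
  | one => simp
  | mul_simple_left w i ih =>
    rw [map_mul, geomRep_simple]
    exact (M.rootForm_rootReflection (M.rootForm_single_self i) _ _).trans ih

theorem rootForm_rootAt (w : W) (i : B) : M.rootForm (cs.rootAt w i) (cs.rootAt w i) = 1 := by
  rw [rootAt, rootForm_geomRep, M.rootForm_single_self]

theorem rootAt_mul_simple (w : W) (i j : B) :
    cs.rootAt (w * cs.simple i) j =
      cs.rootAt w j + (2 * Real.cos (Real.pi / (M i j : ℝ))) • cs.rootAt w i := by
  simp only [rootAt, map_mul, Module.End.mul_apply, geomRep_simple, M.rootReflection_apply,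
    M.rootForm_single_single, map_sub, map_smul]
  module

theorem rootAt_mul_simple_self (w : W) (i : B) :
    cs.rootAt (w * cs.simple i) i = - cs.rootAt w i := by
  rw [rootAt_mul_simple]
  simp only [M.diagonal, Nat.cast_one, div_one, Real.cos_pi]
  module

theorem rootAt_mul_simple_of_eq_two {i j : B} (h : M i j = 2) (w : W) :
    cs.rootAt (w * cs.simple i) j = cs.rootAt w j := by
  simp [rootAt_mul_simple, h]

theorem rootAt_mul_simple_of_eq_three {i j : B} (h : M i j = 3) (w : W) :
    cs.rootAt (w * cs.simple i) j = cs.rootAt w j + cs.rootAt w i := by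
  simp [rootAt_mul_simple, h]

theorem rootAt_mul_mul_of_eq_three {i j : B} (h : M i j = 3) (w : W) :
    cs.rootAt (w * cs.simple i * cs.simple j) i = cs.rootAt w j := by
  rw [cs.rootAt_mul_simple_of_eq_three (M.symmetric i j ▸ h), rootAt_mul_simple_self,
    cs.rootAt_mul_simple_of_eq_three h]
  abel

theorem simple_mul_simple_comm {i j : B} (h : M i j = 2) :
    cs.simple i * cs.simple j = cs.simple j * cs.simple i := by
  have h2 := cs.simple_mul_simple_pow i j
  rw [h, pow_two] at h2
  rw [eq_inv_of_mul_eq_one_left h2]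
  simp

theorem simple_braid {i j : B} (h : M i j = 3) :
    cs.simple i * cs.simple j * cs.simple i = cs.simple j * cs.simple i * cs.simple j := by
  have h2 := cs.simple_mul_simple_pow i j
  rw [h] at h2
  have h3 : (cs.simple i * cs.simple j * cs.simple i) *
      (cs.simple j * cs.simple i * cs.simple j) = 1 := by
    rw [← h2]; simp only [pow_succ, pow_zero, one_mul, mul_assoc]
  rw [eq_inv_of_mul_eq_one_left h3]
  simp [mul_assoc]

/-- Induction on length, peeling off a right descent `s_j` of `w` and computing in the rank two
subgroup generated by `s_i` and `s_j`. -/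
theorem rootAt_nonneg (hM : M.IsSimplyLaced) {w : W} {i : B}
    (h : cs.length w < cs.length (w * cs.simple i)) : 0 ≤ cs.rootAt w i := by
  induction hn : cs.length w using Nat.strong_induction_on generalizing w i with
  | _ n ih =>
  subst hn
  by_cases hw : w = 1
  · subst hw
    simp [rootAt]
  obtain ⟨j, hj⟩ := cs.exists_rightDescent_of_ne_one hw
  have hij : i ≠ j := by
    rintro rfl
    exact absurd h (not_lt.mpr (le_of_lt hj))
  obtain ⟨u, rfl⟩ : ∃ u, w = u * cs.simple j := ⟨w * cs.simple j, by simp⟩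
  rw [IsRightDescent, cs.simple_mul_simple_cancel_right] at hj
  have hu := cs.length_mul_simple u j
  have hui := cs.length_mul_simple u i
  rcases hM j i hij.symm with hm | hm
  · rw [cs.rootAt_mul_simple_of_eq_two hm]
    refine ih _ hj ?_ rfl
    have hle := cs.length_mul_le (u * cs.simple i) (cs.simple j)
    rw [mul_assoc, ← cs.simple_mul_simple_comm hm, ← mul_assoc, cs.length_simple] at hle
    omega
  · rw [cs.rootAt_mul_simple_of_eq_three hm]
    rcases hui with hui | hui
    · exact add_nonneg (ih _ hj (by omega) rfl) (ih _ hj hj rfl)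
    -- Here `w = x s_i s_j` and `w α_i = x α_j`. Since `w s_i = x s_j s_i s_j` has length `ℓ(x) +
    -- 3`, the length of `x s_j` must exceed that of `x`.
    obtain ⟨x, rfl⟩ : ∃ x, u = x * cs.simple i := ⟨u * cs.simple i, by simp⟩
    rw [cs.simple_mul_simple_cancel_right] at hui
    rw [← cs.rootAt_mul_simple_of_eq_three hm,
      cs.rootAt_mul_mul_of_eq_three (M.symmetric i j ▸ hm)]
    refine ih _ (by omega) ?_ rfl
    have hle := cs.length_mul_le (x * cs.simple j) (cs.simple i * cs.simple j)
    have hle2 := cs.length_mul_le (cs.simple i) (cs.simple j)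
    have e : x * cs.simple i * cs.simple j * cs.simple i =
        x * cs.simple j * (cs.simple i * cs.simple j) := by
      simpa [mul_assoc] using congrArg (x * ·) (cs.simple_braid (M.symmetric i j ▸ hm))
    rw [e] at h
    simp only [cs.length_simple] at hle2
    have hxj := cs.length_mul_simple x j
    omega

theorem rootAt_nonpos (hM : M.IsSimplyLaced) {w : W} {i : B}
    (h : cs.length (w * cs.simple i) < cs.length w) : cs.rootAt w i ≤ 0 := by
  have h2 := cs.rootAt_nonneg hM (w := w * cs.simple i) (i := i) (by simpa using h)
  rw [rootAt_mul_simple_self] at h2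
  simpa using h2

theorem rootAt_ne_zero (w : W) (i : B) : cs.rootAt w i ≠ 0 := fun h => by
  have h1 := cs.rootForm_rootAt w i
  simp [h] at h1

theorem rootAt_nonneg_iff (hM : M.IsSimplyLaced) {w : W} {i : B} :
    0 ≤ cs.rootAt w i ↔ cs.length w < cs.length (w * cs.simple i) := by
  refine ⟨fun h => ?_, cs.rootAt_nonneg hM⟩
  by_contra h2
  have h3 := lt_of_le_of_ne (not_lt.mp h2) (cs.length_mul_simple_ne w i)
  exact cs.rootAt_ne_zero w i (le_antisymm (cs.rootAt_nonpos hM h3) h)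

theorem geomRep_reflection (w : W) (i : B) :
    cs.geomRep (w * cs.simple i * w⁻¹) = M.rootReflection (cs.rootAt w i) := by
  refine LinearMap.ext fun v => ?_
  obtain ⟨x, rfl⟩ : ∃ x, v = cs.geomRep w x :=
    ⟨cs.geomRep w⁻¹ v, by rw [← Module.End.mul_apply, ← map_mul]; simp⟩
  rw [← Module.End.mul_apply, ← map_mul, inv_mul_cancel_right, map_mul, Module.End.mul_apply,
    geomRep_simple, M.rootReflection_apply, M.rootReflection_apply, rootAt, rootForm_geomRep,
    map_sub, map_smul]

/-- `posRoot` is an arbitrary choice; it is pinned down because a nonnegative unit vector is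
determined by its reflection. -/
theorem posRoot_eq_rootAt (hM : M.IsSimplyLaced) {w : W} {i : B}
    (h : cs.length w < cs.length (w * cs.simple i)) :
    cs.posRoot (w * cs.simple i * w⁻¹) = cs.rootAt w i := by
  have h1 : cs.IsPosRootOf (w * cs.simple i * w⁻¹) (cs.rootAt w i) :=
    ⟨⟨w, i, rfl⟩, fun k => cs.rootAt_nonneg hM h k, cs.geomRep_reflection w i⟩
  obtain ⟨⟨u, j, hu⟩, h0, hr⟩ : cs.IsPosRootOf (w * cs.simple i * w⁻¹) (cs.posRoot _) :=
    Classical.epsilon_spec ⟨_, h1⟩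
  refine M.eq_of_rootReflection_eq ?_ (cs.rootForm_rootAt w i) (fun k => h0 k)
    (cs.rootAt_nonneg hM h) (hr.symm.trans h1.2.2)
  rw [hu]
  exact cs.rootForm_rootAt u j

theorem posRoot_eq_neg_rootAt (hM : M.IsSimplyLaced) {w : W} {i : B}
    (h : cs.length (w * cs.simple i) < cs.length w) :
    cs.posRoot (w * cs.simple i * w⁻¹) = - cs.rootAt w i := by
  have h2 := cs.posRoot_eq_rootAt hM (w := w * cs.simple i) (i := i) (by simpa using h)
  rw [← rootAt_mul_simple_self, ← h2]
  simp [mul_assoc]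

end CoxeterSystem
end

/-! ### Representations in seminormal form. -/

noncomputable section

namespace CoxeterSystem

variable {B : Type*} {M : CoxeterMatrix B} {W : Type*} [Group W] (cs : CoxeterSystem M W)

/-- Coefficients of a seminormal form `C_w ↦ a(w,i) C_w + b(w,i) C_{w s_i}`, subject to the
relations which make these operators satisfy the simply laced Coxeter relations. -/
structure SeminormalData (F : Type*) [Field F] where
  a : W → B → F
  b : W → B → F
  a_self : ∀ w i, a (w * cs.simple i) i = - a w i
  b_mul_b : ∀ w i, b w i * b (w * cs.simple i) i = 1 - a w i ^ 2
  a_comm : ∀ w i j, M i j = 2 → a (w * cs.simple i) j = a w j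
  b_comm : ∀ w i j, M i j = 2 → b (w * cs.simple i) j = b w j
  a_swap : ∀ w i j, M i j = 3 → a (w * cs.simple i) j = a (w * cs.simple j) i
  b_swap : ∀ w i j, M i j = 3 → b (w * cs.simple i) j = b (w * cs.simple j) i
  a_braid : ∀ w i j, M i j = 3 → a (w * cs.simple i * cs.simple j) i = a w j
  b_braid : ∀ w i j, M i j = 3 → b (w * cs.simple i * cs.simple j) i = b w j
  a_mul_a : ∀ w i j, M i j = 3 → a w i * a w j = a (w * cs.simple i) j * (a w i + a w j)

namespace SeminormalData

variable {cs} {F : Type*} [Field F] (D : cs.SeminormalData F)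
  {X : Type*} [AddCommGroup X] [Module F X] (C : Module.Basis W F X)

/-- The operator `C_w ↦ a(w,i) C_w + b(w,i) C_{w s_i}`. -/
def op (i : B) : Module.End F X :=
  C.constr F fun w => D.a w i • C w + D.b w i • C (w * cs.simple i)

theorem op_basis (i : B) (w : W) :
    D.op C i (C w) = D.a w i • C w + D.b w i • C (w * cs.simple i) :=
  C.constr_basis F _ w

theorem op_mul_self (i : B) : D.op C i * D.op C i = 1 := by
  refine C.ext fun w => ?_
  simp only [Module.End.mul_apply, Module.End.one_apply, op_basis, map_add, map_smul, D.a_self,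
    simple_mul_simple_cancel_right]
  have h := D.b_mul_b w i
  match_scalars
  · linear_combination h
  · ring

theorem op_comm {i j : B} (h : M i j = 2) : D.op C i * D.op C j = D.op C j * D.op C i := by
  have h' : M j i = 2 := M.symmetric i j ▸ h
  refine C.ext fun w => ?_
  simp only [Module.End.mul_apply, op_basis, map_add, map_smul, D.a_comm _ _ _ h,
    D.b_comm _ _ _ h, D.a_comm _ _ _ h', D.b_comm _ _ _ h', mul_assoc,
    cs.simple_mul_simple_comm h]
  module

/-- Put `p = a(w,i)`, `q = a(w,j)`, `r = a(w s_i, j) = a(w s_j, i)`. At `C_w` the two sides differ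
by `(p - q)(pq - r(p + q))`, at `C_{w s_i}` and `C_{w s_j}` by multiples of the second factor, which
`a_mul_a` kills; the other coefficients agree identically. -/
theorem op_braid {i j : B} (h : M i j = 3) :
    D.op C i * D.op C j * D.op C i = D.op C j * D.op C i * D.op C j := by
  have h' : M j i = 3 := M.symmetric i j ▸ h
  refine C.ext fun w => ?_
  have e : w * cs.simple i * cs.simple j * cs.simple i =
      w * cs.simple j * cs.simple i * cs.simple j := by
    simpa [mul_assoc] using congrArg (w * ·) (cs.simple_braid h)
  simp only [Module.End.mul_apply, op_basis, map_add, map_smul, D.a_self,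
    D.a_swap w i j h, D.b_swap w i j h, D.a_braid _ _ _ h, D.b_braid _ _ _ h,
    D.a_braid _ _ _ h', D.b_braid _ _ _ h', simple_mul_simple_cancel_right, e]
  have hi := D.b_mul_b w i
  have hj := D.b_mul_b w j
  have ha := D.a_mul_a w i j h
  rw [D.a_swap w i j h] at ha
  match_scalars
  · linear_combination (D.a (w * cs.simple j) i) * (hi - hj) + (D.a w i - D.a w j) * ha
  · linear_combination (D.b w i) * ha
  · linear_combination -(D.b w j) * ha
  all_goals ring

theorem op_isLiftable (hM : M.IsSimplyLaced) : M.IsLiftable (D.op C) := by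
  intro i j
  by_cases hij : i = j
  · subst hij
    rw [M.diagonal, pow_one, op_mul_self]
  have hi := D.op_mul_self C i
  have hj := D.op_mul_self C j
  rcases hM i j hij with h | h
  · rw [h, pow_two]
    nth_rewrite 2 [D.op_comm C h]
    rw [mul_assoc, ← mul_assoc (D.op C j), hj, one_mul, hi]
  · have hb := D.op_braid C h
    rw [h]
    calc (D.op C i * D.op C j) ^ 3
        = (D.op C i * D.op C j * D.op C i) * (D.op C j * D.op C i * D.op C j) := by
          simp only [pow_succ, pow_zero, one_mul, mul_assoc]
      _ = D.op C i * D.op C j * (D.op C i * D.op C i) * (D.op C j * D.op C i) := by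
          rw [← hb]; simp only [mul_assoc]
      _ = 1 := by
          rw [hi, mul_one, mul_assoc, ← mul_assoc (D.op C j), hj, one_mul, hi]

/-- The representation in seminormal form. -/
def rep (hM : M.IsSimplyLaced) : Representation F W X := cs.lift ⟨D.op C, D.op_isLiftable C hM⟩

theorem rep_simple (hM : M.IsSimplyLaced) (i : B) : D.rep C hM (cs.simple i) = D.op C i :=
  cs.lift_apply_simple (D.op_isLiftable C hM) i

variable {D C}

theorem eq_rep (hM : M.IsSimplyLaced) {ρ : Representation F W X}
    (hρ : ∀ i w, ρ (cs.simple i) (C w) = D.a w i • C w + D.b w i • C (w * cs.simple i)) :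
    ρ = D.rep C hM := by
  refine cs.ext_simple fun i => ?_
  rw [rep_simple]
  exact C.ext fun w => by rw [hρ, op_basis]

/-- The span of the orbit is invariant, and `C_{w s_i}` is recovered from `ρ_{s_i} C_w` by
subtracting a multiple of `C_w` and dividing by `b w i`. -/
theorem basis_mem_span_orbit (hb : ∀ w i, D.b w i ≠ 0) {ρ : Representation F W X}
    (hρ : ∀ i w, ρ (cs.simple i) (C w) = D.a w i • C w + D.b w i • C (w * cs.simple i)) (w : W) :
    C w ∈ Submodule.span F (Set.range fun g => ρ g (C 1)) := by
  induction w using cs.simple_induction_right with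
  | one => exact Submodule.subset_span ⟨1, by simp⟩
  | mul_simple_right w i ih =>
    have hs : ∀ x ∈ Submodule.span F (Set.range fun g => ρ g (C 1)),
        ρ (cs.simple i) x ∈ Submodule.span F (Set.range fun g => ρ g (C 1)) := by
      intro x hx
      induction hx using Submodule.span_induction with
      | mem x hx =>
        obtain ⟨g, rfl⟩ := hx
        exact Submodule.subset_span ⟨cs.simple i * g, by simp⟩
      | zero => simp
      | add x y _ _ hx hy => rw [map_add]; exact add_mem hx hy
      | smul c x _ hx => rw [map_smul]; exact Submodule.smul_mem _ _ hx
    rw [← Submodule.smul_mem_iff _ (hb w i), ← sub_eq_iff_eq_add'.mpr (hρ i w)]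
    exact sub_mem (hs _ ih) (Submodule.smul_mem _ _ ih)

/-- The regular representation is free on one generator, sent here to the cyclic vector `C 1`; both
sides have dimension `|W|`. -/
theorem nonempty_equiv_leftRegular [Finite W] (hb : ∀ w i, D.b w i ≠ 0)
    {ρ : Representation F W X}
    (hρ : ∀ i w, ρ (cs.simple i) (C w) = D.a w i • C w + D.b w i • C (w * cs.simple i)) :
    Nonempty (ρ.Equiv (Representation.leftRegular F W)) := by
  let φ : (Representation.leftRegular F W).IntertwiningMap ρ :=
    (Representation.leftRegularMapEquiv ρ).symm (C 1)
  have hφ : ∀ g, φ (.single g 1) = ρ g (C 1) := fun g =>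
    Representation.leftRegularMapEquiv_symm_single (σ := ρ) g (C 1)
  have hsurj : Function.Surjective φ.toLinearMap := by
    rw [← LinearMap.range_eq_top, eq_top_iff, ← C.span_eq, Submodule.span_le]
    rintro _ ⟨w, rfl⟩
    refine Submodule.span_le.mpr ?_ (basis_mem_span_orbit hb hρ w)
    rintro _ ⟨g, rfl⟩
    exact ⟨_, hφ g⟩
  let e : MonoidAlgebra F W ≃ₗ[F] X := MonoidAlgebra.coeffLinearEquiv F ≪≫ₗ C.repr.symm
  have : Module.Finite F X := Module.Finite.of_basis C
  have : Module.Finite F (MonoidAlgebra F W) := Module.Finite.equiv e.symm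
  have hinj : Function.Injective φ.toLinearMap :=
    (LinearMap.injective_iff_surjective_of_finrank_eq_finrank e.finrank_eq).mpr hsurj
  exact ⟨(φ.ofBijective ⟨hinj, hsurj⟩).symm⟩

end SeminormalData

end CoxeterSystem
end

/-! ### The Young representation as seminormal data. -/

noncomputable section

namespace CoxeterSystem

section cellBasis

variable {W : Type*} (F : Type*) [Field F]

/-- The basis `C_w` of `V_W`. -/
def cellBasis {K : Set W} (hK : K = Set.univ) :
    Module.Basis W F (K →₀ F) :=
  Finsupp.basisSingleOne.reindex ((Equiv.setCongr hK).trans (Equiv.Set.univ W))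

theorem cellBasis_apply {K : Set W} (hK : K = Set.univ) (w : W) :
    cellBasis F hK w = Finsupp.single ⟨w, hK ▸ Set.mem_univ w⟩ 1 := by
  simp [cellBasis]

variable {F}

theorem smul_cellBasis {K : Set W} (hK : K = Set.univ) (w : W) (c : F) :
    c • cellBasis F hK w = cellVector K w c := by
  rw [cellBasis_apply, cellVector, dif_pos (hK ▸ Set.mem_univ w), Finsupp.smul_single_one]

end cellBasis

variable {B : Type*} {M : CoxeterMatrix B} {W : Type*} [Group W] (cs : CoxeterSystem M W)

/-- This and the next three identities mirror those for roots. The coefficient `b` is a function of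
the reflection and the root alone, so it inherits its relations from the two lists. -/
theorem reflection_mul_simple_self (w : W) (i : B) :
    w * cs.simple i * cs.simple i * (w * cs.simple i)⁻¹ = w * cs.simple i * w⁻¹ := by
  simp [mul_assoc]

theorem reflection_mul_simple_of_eq_two {i j : B} (h : M i j = 2) (w : W) :
    w * cs.simple i * cs.simple j * (w * cs.simple i)⁻¹ = w * cs.simple j * w⁻¹ := by
  rw [mul_assoc w, cs.simple_mul_simple_comm h]
  simp [mul_assoc]

theorem reflection_mul_simple_of_eq_three {i j : B} (h : M i j = 3) (w : W) :
    w * cs.simple i * cs.simple j * (w * cs.simple i)⁻¹ =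
      w * cs.simple j * cs.simple i * (w * cs.simple j)⁻¹ := by
  simpa [mul_assoc] using congrArg (fun x => w * x * w⁻¹) (cs.simple_braid h)

theorem reflection_mul_mul_of_eq_three {i j : B} (h : M i j = 3) (w : W) :
    w * cs.simple i * cs.simple j * cs.simple i * (w * cs.simple i * cs.simple j)⁻¹ =
      w * cs.simple j * w⁻¹ := by
  have := congrArg (fun x => w * x * (cs.simple i * cs.simple j)⁻¹ * w⁻¹) (cs.simple_braid h)
  simpa [mul_assoc] using this

variable {F : Type*} [Field F] [Algebra ℝ F]

open Classical in
/-- The scalar `ḃ_t` if the root `β` is positive and `b̈_t` otherwise. -/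
def signedB {K : Set W} {f : Module.Dual ℝ (B →₀ ℝ)} (N : cs.Normalization F K f)
    (t : W) (β : B →₀ ℝ) : F :=
  if 0 ≤ β then N.bDot t else N.bDDot t

variable {cs}

/-- The excluded set {0, 1, -1} is symmetric, so the condition passes from positive roots to all
roots. -/
theorem apply_rootAt_ne (hM : M.IsSimplyLaced) {f : Module.Dual ℝ (B →₀ ℝ)}
    (hf : ∀ t : W, cs.IsReflection t → f (cs.posRoot t) ∉ ({0, 1, -1} : Set ℝ)) (w : W) (i : B) :
    f (cs.rootAt w i) ≠ 0 ∧ f (cs.rootAt w i) ^ 2 ≠ 1 := by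
  have h := hf _ ⟨w, i, rfl⟩
  rw [sq_ne_one_iff]
  rcases lt_or_gt_of_ne (cs.length_mul_simple_ne w i) with hl | hl
  · simp only [cs.posRoot_eq_neg_rootAt hM hl, map_neg, Set.mem_insert_iff,
      Set.mem_singleton_iff, not_or] at h
    exact ⟨fun h' => h.1 (by simp [h']), fun h' => h.2.2 (by rw [h']),
      fun h' => h.2.1 (by simp [h'])⟩
  · rw [cs.posRoot_eq_rootAt hM hl] at h
    simpa using h

theorem aDot_of_lt (hM : M.IsSimplyLaced) (f : Module.Dual ℝ (B →₀ ℝ)) {w : W} {i : B}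
    (h : cs.length w < cs.length (w * cs.simple i)) :
    cs.aDot F f (w * cs.simple i * w⁻¹) = algebraMap ℝ F (1 / f (cs.rootAt w i)) := by
  rw [aDot, cs.posRoot_eq_rootAt hM h]

theorem aDot_of_gt (hM : M.IsSimplyLaced) (f : Module.Dual ℝ (B →₀ ℝ)) {w : W} {i : B}
    (h : cs.length (w * cs.simple i) < cs.length w) :
    - cs.aDot F f (w * cs.simple i * w⁻¹) = algebraMap ℝ F (1 / f (cs.rootAt w i)) := by
  rw [aDot, cs.posRoot_eq_neg_rootAt hM h]
  simp

theorem signedB_of_lt (hM : M.IsSimplyLaced) {K : Set W} {f : Module.Dual ℝ (B →₀ ℝ)}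
    (N : cs.Normalization F K f) {w : W} {i : B} (h : cs.length w < cs.length (w * cs.simple i))
    (t : W) : cs.signedB N t (cs.rootAt w i) = N.bDot t :=
  if_pos (cs.rootAt_nonneg hM h)

theorem signedB_of_gt (hM : M.IsSimplyLaced) {K : Set W} {f : Module.Dual ℝ (B →₀ ℝ)}
    (N : cs.Normalization F K f) {w : W} {i : B} (h : cs.length (w * cs.simple i) < cs.length w)
    (t : W) : cs.signedB N t (cs.rootAt w i) = N.bDDot t :=
  if_neg fun h' => lt_asymm h ((cs.rootAt_nonneg_iff hM).mp h')

/-- The coefficients of the abstract Young representation attached to a `W`-generic functional. -/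
def youngData (hM : M.IsSimplyLaced) {f : Module.Dual ℝ (B →₀ ℝ)}
    (hf : ∀ t : W, cs.IsReflection t → f (cs.posRoot t) ∉ ({0, 1, -1} : Set ℝ))
    {K : Set W} (hK : K = Set.univ) (N : cs.Normalization F K f) : cs.SeminormalData F where
  a w i := algebraMap ℝ F (1 / f (cs.rootAt w i))
  b w i := cs.signedB N (w * cs.simple i * w⁻¹) (cs.rootAt w i)
  a_self w i := by
    rw [rootAt_mul_simple_self]
    simp
  b_mul_b w i := by
    have hN := N.mul_eq (w * cs.simple i * w⁻¹)
      (Or.inl ⟨i, w, by rw [hK]; trivial, by rw [hK]; trivial, rfl⟩)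
    rw [reflection_mul_simple_self]
    -- The pairs at `w` and `w s_i` share a reflection and have opposite roots, so one factor is
    -- `bDot` and the other `bDDot`.
    rcases lt_or_gt_of_ne (cs.length_mul_simple_ne w i) with hl | hl
    · rw [signedB_of_gt hM N hl, signedB_of_lt hM N (by simpa using hl), mul_comm, hN,
        aDot_of_gt hM f hl, ← neg_neg (cs.aDot F f _), aDot_of_gt hM f hl]
      ring
    · rw [signedB_of_lt hM N hl, signedB_of_gt hM N (by simpa using hl), hN, aDot_of_lt hM f hl]
      ring
  a_comm w i j h := by rw [cs.rootAt_mul_simple_of_eq_two h]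
  b_comm w i j h := by
    rw [cs.rootAt_mul_simple_of_eq_two h, cs.reflection_mul_simple_of_eq_two h]
  a_swap w i j h := by
    rw [cs.rootAt_mul_simple_of_eq_three h,
      cs.rootAt_mul_simple_of_eq_three (M.symmetric i j ▸ h), add_comm]
  b_swap w i j h := by
    rw [cs.rootAt_mul_simple_of_eq_three h, cs.reflection_mul_simple_of_eq_three h,
      cs.rootAt_mul_simple_of_eq_three (M.symmetric i j ▸ h), add_comm]
  a_braid w i j h := by rw [cs.rootAt_mul_mul_of_eq_three h]
  b_braid w i j h := by
    rw [cs.rootAt_mul_mul_of_eq_three h, cs.reflection_mul_mul_of_eq_three h]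
  a_mul_a w i j h := by
    have hi := (apply_rootAt_ne hM hf w i).1
    have hj := (apply_rootAt_ne hM hf w j).1
    -- This is the nonvanishing of the sum `f(w α_i) + f(w α_j)`, needed to clear denominators.
    have hij := (apply_rootAt_ne hM hf (w * cs.simple i) j).1
    rw [cs.rootAt_mul_simple_of_eq_three h] at hij ⊢
    rw [map_add f] at hij ⊢
    rw [← map_mul, ← map_add (algebraMap ℝ F), ← map_mul]
    congr 1
    field_simp

/-- A zero would force `a² = 1` in `b_mul_b`, that is `f(w α_i) = ±1`. -/
theorem youngData_b_ne_zero (hM : M.IsSimplyLaced) {f : Module.Dual ℝ (B →₀ ℝ)}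
    (hf : ∀ t : W, cs.IsReflection t → f (cs.posRoot t) ∉ ({0, 1, -1} : Set ℝ))
    {K : Set W} (hK : K = Set.univ) (N : cs.Normalization F K f) (w : W) (i : B) :
    (youngData hM hf hK N).b w i ≠ 0 := by
  intro h0
  have h := (youngData hM hf hK N).b_mul_b w i
  have h2 := apply_rootAt_ne hM hf w i
  have h3 : (algebraMap ℝ F (1 / f (cs.rootAt w i))) ^ 2 = 1 := by
    rw [h0, zero_mul, eq_comm, sub_eq_zero] at h
    exact h.symm
  rw [← map_pow, ← map_one (algebraMap ℝ F)] at h3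
  have h4 := (algebraMap ℝ F).injective h3
  rw [one_div, inv_pow, inv_eq_one] at h4
  exact h2.2 h4

/-- The sign of `w α_i` absorbs the length distinction, and the zero branch of `cellVector` never
occurs because `K` is everything. -/
theorem isYoungRep_iff (hM : M.IsSimplyLaced) {f : Module.Dual ℝ (B →₀ ℝ)}
    (hf : ∀ t : W, cs.IsReflection t → f (cs.posRoot t) ∉ ({0, 1, -1} : Set ℝ))
    {K : Set W} (hK : K = Set.univ) (N : cs.Normalization F K f)
    (ρ : Representation F W (K →₀ F)) :
    cs.IsYoungRep K f N ρ ↔ ∀ i w, ρ (cs.simple i) (cellBasis F hK w) =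
      (youngData hM hf hK N).a w i • cellBasis F hK w +
        (youngData hM hf hK N).b w i • cellBasis F hK (w * cs.simple i) := by
  refine forall_congr' fun i => ?_
  have hw : ∀ w, w ∈ K := fun w => hK ▸ Set.mem_univ w
  refine ⟨fun h w => ?_, fun h w => ?_⟩
  · rw [smul_cellBasis _ (w * cs.simple i), cellBasis_apply, Finsupp.smul_single_one]
    rcases lt_or_gt_of_ne (cs.length_mul_simple_ne w i) with hl | hl
    · refine ((h ⟨w, hw w⟩).2 hl).trans ?_
      simp only [youngData, aDot_of_gt hM f hl, signedB_of_gt hM N hl]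
    · refine ((h ⟨w, hw w⟩).1 hl).trans ?_
      simp only [youngData, aDot_of_lt hM f hl, signedB_of_lt hM N hl]
  · have h := h w
    rw [smul_cellBasis _ (w * cs.simple i), cellBasis_apply, Finsupp.smul_single_one] at h
    refine ⟨fun hl => h.trans ?_, fun hl => h.trans ?_⟩
    · simp only [youngData, aDot_of_lt hM f hl, signedB_of_lt hM N hl]
    · simp only [youngData, aDot_of_gt hM f hl, signedB_of_gt hM N hl]

/-! ### The cell of a generic functional, and the theorem. -/

theorem unitReflections_eq_empty {f : Module.Dual ℝ (B →₀ ℝ)}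
    (hf : ∀ t : W, cs.IsReflection t → f (cs.posRoot t) ∉ ({0, 1, -1} : Set ℝ)) :
    cs.unitReflections f = ∅ :=
  Set.eq_empty_of_forall_notMem fun t ht => hf t ht.1 (Or.inr ht.2)

theorem cell_eq_univ {f : Module.Dual ℝ (B →₀ ℝ)}
    (hf : ∀ t : W, cs.IsReflection t → f (cs.posRoot t) ∉ ({0, 1, -1} : Set ℝ)) (v : W) :
    cs.cell f v = Set.univ := by
  simp [cell, descentSet, unitReflections_eq_empty hf]

theorem isGeneric_univ {f : Module.Dual ℝ (B →₀ ℝ)}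
    (hf : ∀ t : W, cs.IsReflection t → f (cs.posRoot t) ∉ ({0, 1, -1} : Set ℝ)) :
    cs.IsGeneric Set.univ f where
  convex _ _ _ _ _ _ := Set.mem_univ _
  one_mem := Set.mem_univ _
  inner := by
    rintro t ⟨i, w, -, -, rfl⟩
    exact hf _ ⟨w, i, rfl⟩
  boundary := by
    rintro t ⟨i, w, -, h, -⟩
    exact absurd (Set.mem_univ _) h
  corner _ _ _ _ _ h := absurd (Set.mem_univ _) h

end CoxeterSystem
end

theorem theorem3p5 {B W F : Type*} [Group W] [Finite W] [Field F] [Algebra ℝ F]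
    {M : CoxeterMatrix B} (cs : CoxeterSystem M W) (hM : M.IsSimplyLaced)
    (f : Module.Dual ℝ (B →₀ ℝ))
    (hf : ∀ t : W, cs.IsReflection t → f (cs.posRoot t) ∉ ({0, 1, -1} : Set ℝ))
    (v : W) :
    cs.cell f v = Set.univ ∧ cs.IsGeneric (cs.cell f v) f ∧
      ∀ N : cs.Normalization F (cs.cell f v) f,
        (∃! ρ : Representation F W (cs.cell f v →₀ F), cs.IsYoungRep (cs.cell f v) f N ρ) ∧
        ∀ ρ : Representation F W (cs.cell f v →₀ F), cs.IsYoungRep (cs.cell f v) f N ρ →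
          Nonempty (ρ.Equiv (Representation.leftRegular F W)) := by
  -- The cell equals `W` only propositionally; passing this equality as an argument avoids
  -- transporting `ρ` and `N` between types.
  have hK := CoxeterSystem.cell_eq_univ hf v
  refine ⟨hK, hK ▸ CoxeterSystem.isGeneric_univ hf, fun N => ?_⟩
  have hY := CoxeterSystem.isYoungRep_iff hM hf hK N
  refine ⟨⟨_, (hY _).mpr fun i w => ?_, fun ρ hρ =>
    CoxeterSystem.SeminormalData.eq_rep hM ((hY ρ).mp hρ)⟩, fun ρ hρ =>
    CoxeterSystem.SeminormalData.nonempty_equiv_leftRegular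
      (CoxeterSystem.youngData_b_ne_zero hM hf hK N) ((hY ρ).mp hρ)⟩
  rw [CoxeterSystem.SeminormalData.rep_simple, CoxeterSystem.SeminormalData.op_basis]
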